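/- Let $\eta\in\mathbb C\setminus\{0\}$, and write $\Delta f(z)=f(z+\eta)-f(z)$, $\Delta^{j}f=\Delta(\Delta^{j-1}f)$ for $j\ge 2$. Let $P_0,\dots,P_n$ be polynomials with complex coefficients such that $P_0\not\equiv 0$ and $$\max_{1\le j\le n}\deg P_j\le \deg P_0 .$$ Let $f\not\equiv 0$ be a meromorphic function in the complex plane that satisfies the difference equation $$P_n(z)\Delta^n f(z)+\cdots+P_1(z)\Delta f(z)+P_0(z)f(z)=0$$ (as an identity between meromorphic functions). Then $\sigma(f)\ge 1$, where $$\sigma(f)=\limsup_{r\to\infty}\frac{\log^+ T(r,f)}{\log r}\in[0,\infty]$$ is the order of growth of $f$ and $T(r,f)$ is its Nevanlinna characteristic. -/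

import Mathlib

open Filter Polynomial

/-- The (Nevanlinna) order of growth `limsup_{r → ∞} log⁺ T(r, f) / log r` of a meromorphic
function `f` in the complex plane, an extended real number that may be `⊤`. Here
`T(r, f) = m(r, f) + N(r, f)` is the Nevanlinna characteristic of `f`. -/
noncomputable def nevanlinnaOrder (f : ℂ → ℂ) : EReal :=
  limsup (fun r : ℝ ↦
    ((Real.posLog (ValueDistribution.characteristic f ⊤ r) / Real.log r : ℝ) : EReal)) atTop

open MeasureTheory Asymptotics

/-! A function of order less than one is almost invariant under bounded translations: at suitable
points `z` arbitrarily far out, `f (z + jη) = f z * exp E` with `E` small for all `j ≤ n`. Then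
every `Δ^j f(z)` with `j ≥ 1` is small compared with `f z`, so by the degree condition `P₀ f` cannot
be cancelled in the equation.

Almost invariance (`exists_forall_eq_mul_exp`) comes from writing `f = ∏ (z - u)^(d u) * exp G` on
`|z| < 2R`. If `T(r, f) ≤ r^α` with `α < 1`, the number `N` of zeros and poles is `O(R^α)` and the
mean `A` of `|Re G|` on `|z| = R` is `o(R)`. Harnack and Borel–Carathéodory bound increments of `G`
by `O(A / R)`. The product contributes at most a multiple of `∑ |d u| / |z - u|`, which is `O(N /
R)` at some point of a disc of radius `R / 16`, by averaging. Averaging also lets `z` avoid any null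
set. -/

/-! ### Holomorphic logarithms and growth estimates on discs. -/

/-- A zero-free holomorphic function on a disc has a holomorphic logarithm. -/
theorem exists_eq_exp_on_ball {h : ℂ → ℂ} {c : ℂ} {R : ℝ}
    (hR : 0 < R) (hd : DifferentiableOn ℂ h (Metric.ball c R))
    (h₀ : ∀ w ∈ Metric.ball c R, h w ≠ 0) :
    ∃ G : ℂ → ℂ, DifferentiableOn ℂ G (Metric.ball c R) ∧
      ∀ w ∈ Metric.ball c R, h w = Complex.exp (G w) := by
  have hc : c ∈ Metric.ball c R := Metric.mem_ball_self hR
  have hq : DifferentiableOn ℂ (fun w ↦ deriv h w / h w) (Metric.ball c R) :=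
    (hd.deriv Metric.isOpen_ball).div hd h₀
  obtain ⟨G, hG₀, hG⟩ := hq.isExactOn_ball.with_val_at c (Complex.log (h c))
  have hder : ∀ w ∈ Metric.ball c R,
      HasDerivAt (fun w ↦ h w * Complex.exp (-G w)) 0 w := by
    intro w hw
    have h1 : HasDerivAt h (deriv h w) w :=
      (hd.differentiableAt (Metric.isOpen_ball.mem_nhds hw)).hasDerivAt
    convert! h1.mul (hG w hw).neg.cexp using 1
    have := h₀ w hw
    field_simp
    ring
  refine ⟨G, fun w hw ↦ (hG w hw).differentiableAt.differentiableWithinAt, fun w hw ↦ ?_⟩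
  have hconst := (convex_ball c R).is_const_of_fderivWithin_eq_zero (𝕜 := ℂ)
    (f := fun w ↦ h w * Complex.exp (-G w))
    (fun x hx ↦ (hder x hx).differentiableAt.differentiableWithinAt)
    (fun x hx ↦ by
      rw [fderivWithin_of_isOpen Metric.isOpen_ball hx]
      ext
      simpa using (hder x hx).deriv) hw hc
  simp only [hG₀, Complex.exp_neg, Complex.exp_log (h₀ c hc), mul_inv_cancel₀ (h₀ c hc)] at hconst
  have := Complex.exp_ne_zero (G w)
  field_simp at hconst
  exact hconst

/-- Harnack-type bound for the real part of a holomorphic function by its mean absolute value on a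
circle. -/
theorem abs_re_le_three_mul_circleAverage {F : ℂ → ℂ} {R R' : ℝ} (hR : 0 < R) (hRR' : R < R')
    (hF : DifferentiableOn ℂ F (Metric.ball 0 R')) {w : ℂ} (hw : ‖w‖ ≤ R / 2) :
    |(F w).re| ≤ 3 * Real.circleAverage (fun z ↦ |(F z).re|) 0 R := by
  have hsub : Metric.closedBall (0 : ℂ) R ⊆ Metric.ball 0 R' :=
    Metric.closedBall_subset_ball hRR'
  have hwR : w ∈ Metric.ball (0 : ℂ) R := by
    rw [mem_ball_zero_iff]; linarith
  have hharm : InnerProductSpace.HarmonicOnNhd (fun z ↦ (F z).re) (Metric.closedBall 0 R) :=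
    fun z hz ↦ (hF.analyticAt (Metric.isOpen_ball.mem_nhds (hsub hz))).harmonicAt_re
  have hP := InnerProductSpace.HarmonicOnNhd.circleAverage_re_herglotzRieszKernel_smul hharm hwR
  have hcF : ContinuousOn (fun z ↦ (F z).re) (Metric.sphere 0 |R|) := by
    rw [abs_of_pos hR]
    exact Complex.continuous_re.comp_continuousOn
      (hF.continuousOn.mono (Metric.sphere_subset_closedBall.trans hsub))
  have hcK : ContinuousOn (fun z ↦ (herglotzRieszKernel 0 w z).re) (Metric.sphere 0 |R|) :=
    Complex.continuous_re.comp_continuousOn (continuousOn_herglotzRieszKernel_sphere hwR)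
  rw [← hP]
  refine Real.abs_circleAverage_le_circleAverage_abs.trans ?_
  rw [← smul_eq_mul, ← Real.circleAverage_fun_smul]
  refine Real.circleAverage_mono ?_ ?_ ?_
  · exact ContinuousOn.circleIntegrable' ((hcK.mul hcF).abs)
  · exact ContinuousOn.circleIntegrable' (hcF.abs.const_smul (3 : ℝ))
  · intro z hz
    rw [abs_of_pos hR] at hz
    have h1 := re_herglotzRieszKernel_le hz hwR
    have h2 := le_re_herglotzRieszKernel hz hwR
    rw [← herglotzRieszKernel_def] at h1 h2
    simp only [sub_zero] at h1 h2
    have h3 : (R + ‖w‖) / (R - ‖w‖) ≤ 3 := by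
      rw [div_le_iff₀ (by linarith)]; linarith
    have h4 : 0 ≤ (R - ‖w‖) / (R + ‖w‖) := div_nonneg (by linarith) (by positivity)
    change |(herglotzRieszKernel 0 w z).re * (F z).re| ≤ 3 * |(F z).re|
    rw [abs_mul, abs_of_nonneg (h4.trans h2)]
    gcongr
    exact h1.trans h3

/-- Increments of a holomorphic function are controlled by the mean absolute value of its real part
on a larger circle. -/
theorem norm_sub_le_of_circleAverage_abs_re_le {G : ℂ → ℂ} {R R' A : ℝ} (hR : 0 < R)
    (hRR' : R < R') (hG : DifferentiableOn ℂ G (Metric.ball 0 R')) (hA : 0 < A)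
    (hGA : Real.circleAverage (fun z ↦ |(G z).re|) 0 R ≤ A) {z w : ℂ} (hz : ‖z‖ ≤ R / 4)
    (hw : ‖w‖ ≤ R / 8) :
    ‖G (z + w) - G z‖ ≤ 96 * A * ‖w‖ / R := by
  have hmem : ∀ x ∈ Metric.ball (0 : ℂ) (R / 4), ‖z + x‖ ≤ R / 2 := by
    intro x hx
    rw [mem_ball_zero_iff] at hx
    linarith [norm_add_le z x]
  have hb : ∀ x : ℂ, ‖x‖ ≤ R / 2 → |(G x).re| ≤ 3 * A := fun x hx ↦
    (abs_re_le_three_mul_circleAverage hR hRR' hG hx).trans (by gcongr)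
  -- `M = 6A` bounds the difference of two real parts, each at most `3A` in absolute value. Since
  -- `‖w‖ ≤ R / 8`, the denominator `R / 4 - ‖w‖` is at least `R / 8`, which gives 96.
  have key := Complex.borelCaratheodory_zero (f := fun x ↦ G (z + x) - G z) (M := 6 * A)
    (R := R / 4) (z := w) (by positivity) ?_ ?_ (by positivity) ?_ (by simp)
  · refine key.trans ?_
    rw [div_le_div_iff₀ (by linarith) hR]
    nlinarith [mul_nonneg (mul_nonneg hA.le (norm_nonneg w)) (sub_nonneg.2 hw)]
  · refine DifferentiableOn.sub_const ?_ _
    refine hG.comp (by fun_prop) ?_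
    intro x hx
    rw [mem_ball_zero_iff]
    linarith [hmem x hx]
  · intro x hx
    have h1 := abs_le.1 (hb _ (hmem x hx))
    have h2 := abs_le.1 (hb z (by linarith))
    simp only [Set.mem_ofPred_eq, Complex.sub_re]
    linarith [h1.2, h2.1]
  · rw [mem_ball_zero_iff]; linarith

/-! ### Circle means and counting of zeros and poles. -/

/-- The mean of `|log ‖z - u‖|` over the circle of radius `R`. -/
theorem circleAverage_abs_log_norm_sub_le {u : ℂ} {R : ℝ} (hR : 1 ≤ R) (hu : ‖u‖ ≤ 2 * R) :
    Real.circleAverage (fun z ↦ |Real.log ‖z - u‖|) 0 R ≤ 2 * Real.log (3 * R) := by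
  have hmer : MeromorphicOn (fun z : ℂ ↦ z - u) (Metric.sphere 0 |R|) :=
    fun z _ ↦ by fun_prop
  have hint : CircleIntegrable (fun z ↦ Real.log ‖z - u‖) 0 R := hmer.circleIntegrable_log_norm
  have havg : 0 ≤ Real.circleAverage (fun z ↦ Real.log ‖z - u‖) 0 R := by
    rw [circleAverage_log_norm_sub_const_eq_log_radius_add_posLog (by positivity)]
    exact add_nonneg (Real.log_nonneg hR) Real.posLog_nonneg
  -- If `t ≤ M` and `0 ≤ M` then `|t| ≤ 2M - t`; the mean of `t = log ‖z - u‖` is nonnegative and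
  -- can be dropped.
  have hle : Real.circleAverage (fun z ↦ |Real.log ‖z - u‖|) 0 R ≤
      Real.circleAverage (fun z ↦ 2 * Real.log (3 * R) - Real.log ‖z - u‖) 0 R := by
    refine Real.circleAverage_mono hint.abs ((circleIntegrable_const _ _ _).sub hint) ?_
    intro z hz
    rw [abs_of_pos (by positivity), mem_sphere_zero_iff_norm] at hz
    have hlog : Real.log ‖z - u‖ ≤ Real.log (3 * R) := by
      rcases eq_or_lt_of_le (norm_nonneg (z - u)) with h | h
      · rw [← h, Real.log_zero]
        exact Real.log_nonneg (by linarith)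
      · exact Real.log_le_log h (by linarith [norm_sub_le z u])
    have : 0 ≤ Real.log (3 * R) := Real.log_nonneg (by linarith)
    rw [abs_le]; constructor <;> linarith
  rw [Real.circleAverage_fun_sub (circleIntegrable_const _ _ _) hint,
    Real.circleAverage_const] at hle
  linarith

/-- The logarithmic counting function of an effective divisor dominates the number of its points
in a disc of half the radius. -/
theorem sum_mul_log_two_le_logCounting {D : Function.locallyFinsupp ℂ ℤ} (hD : 0 ≤ D) {r : ℝ}
    (hr : 1 ≤ r) {s : Finset ℂ} (hs : ∀ u ∈ s, ‖u‖ ≤ r) :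
    (∑ u ∈ s, (D u : ℝ)) * Real.log 2 ≤
      Function.locallyFinsuppWithin.logCounting D (2 * r) := by
  classical
  have hD' : ∀ z, (0 : ℝ) ≤ D z := fun z ↦ Int.cast_nonneg (hD z)
  have habs : |2 * r| = 2 * r := abs_of_pos (by linarith)
  have hlog2 : 0 < Real.log 2 := Real.log_pos one_lt_two
  have hlog : Real.log 2 ≤ Real.log (2 * r) := Real.log_le_log two_pos (by linarith)
  simp only [Function.locallyFinsuppWithin.logCounting, AddMonoidHom.coe_mk, ZeroHom.coe_mk]
  set E := Function.locallyFinsuppWithin.toClosedBall (2 * r) D with hE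
  have hEs : E.support.Finite := E.finiteSupport (isCompact_closedBall 0 |2 * r|)
  have hEv : ∀ z, ‖z‖ ≤ 2 * r → E z = D z := fun z hz ↦
    Function.locallyFinsuppWithin.toClosedBall_eval_within D (by simpa [habs] using hz)
  set t := hEs.toFinset ∪ s
  have hts : Function.support (fun z ↦ (E z : ℝ) * Real.log (2 * r * ‖z‖⁻¹)) ⊆ t := by
    intro z hz
    have : E z ≠ 0 := by
      intro h0
      simp [h0] at hz
    simp [t, this]
  rw [finsum_eq_sum_of_support_subset _ hts]
  have hnn : ∀ z, 0 ≤ (E z : ℝ) * Real.log (2 * r * ‖z‖⁻¹) := by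
    intro z
    by_cases hz : ‖z‖ ≤ 2 * r
    · rw [hEv z hz]
      refine mul_nonneg (hD' z) ?_
      rcases eq_or_ne z 0 with rfl | hz0
      · simp
      · apply Real.log_nonneg
        rw [← div_eq_mul_inv, le_div_iff₀ (norm_pos_iff.2 hz0)]
        linarith
    · have : E z = 0 := Function.locallyFinsuppWithin.apply_eq_zero_of_notMem _ (by simpa [habs] using hz)
      simp [this]
  have hsub : ∑ z ∈ s, (E z : ℝ) * Real.log (2 * r * ‖z‖⁻¹) ≤
      ∑ z ∈ t, (E z : ℝ) * Real.log (2 * r * ‖z‖⁻¹) :=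
    Finset.sum_le_sum_of_subset_of_nonneg Finset.subset_union_right fun z _ _ ↦ hnn z
  -- At `u = 0` the logarithm takes the default value 0; the origin is counted by the separate term
  -- `D 0 * log (2r)`.
  have hterm : ∀ u ∈ s, (D u : ℝ) * Real.log 2 ≤
      (E u : ℝ) * Real.log (2 * r * ‖u‖⁻¹) + if u = 0 then (D 0 : ℝ) * Real.log (2 * r) else 0 := by
    intro u hu
    rw [hEv u (by linarith [hs u hu])]
    split_ifs with h
    · subst h
      simpa using mul_le_mul_of_nonneg_left hlog (hD' 0)
    · rw [add_zero]
      refine mul_le_mul_of_nonneg_left (Real.log_le_log two_pos ?_) (hD' u)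
      rw [← div_eq_mul_inv, le_div_iff₀ (norm_pos_iff.2 h)]
      linarith [hs u hu]
  calc (∑ u ∈ s, (D u : ℝ)) * Real.log 2 = ∑ u ∈ s, (D u : ℝ) * Real.log 2 := Finset.sum_mul ..
    _ ≤ _ := Finset.sum_le_sum hterm
    _ = ∑ u ∈ s, (E u : ℝ) * Real.log (2 * r * ‖u‖⁻¹) +
        ∑ u ∈ s, (if u = 0 then (D 0 : ℝ) * Real.log (2 * r) else 0) := Finset.sum_add_distrib
    _ ≤ _ := by
        refine add_le_add hsub ?_
        rw [Finset.sum_ite_eq']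
        split_ifs
        · exact le_rfl
        · exact mul_nonneg (hD' 0) (by linarith)

/-- The number of zeros and poles in a disc is bounded in terms of the characteristics of `f` and
`f⁻¹`. -/
theorem sum_abs_divisor_mul_log_two_le {f : ℂ → ℂ} {r : ℝ} (hr : 1 ≤ r)
    {s : Finset ℂ} (hs : ∀ u ∈ s, ‖u‖ ≤ r) :
    (∑ u ∈ s, |(MeromorphicOn.divisor f Set.univ u : ℝ)|) * Real.log 2 ≤
      ValueDistribution.characteristic f ⊤ (2 * r) +
        ValueDistribution.characteristic f⁻¹ ⊤ (2 * r) := by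
  set D := MeromorphicOn.divisor f Set.univ
  have h1 := sum_mul_log_two_le_logCounting (D := D⁺) (posPart_nonneg D) hr hs
  have h2 := sum_mul_log_two_le_logCounting (D := D⁻) (negPart_nonneg D) hr hs
  have h3 : ∀ u, |(D u : ℝ)| = (D⁺ u : ℝ) + (D⁻ u : ℝ) := by
    intro u
    rw [← Int.cast_abs, ← posPart_add_negPart (D u), Int.cast_add]
    rfl
  rw [← ValueDistribution.logCounting_zero] at h1
  rw [← ValueDistribution.logCounting_top] at h2
  simp only [ValueDistribution.characteristic, Pi.add_apply, ValueDistribution.logCounting_inv]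
  simp only [h3, Finset.sum_add_distrib, add_mul]
  have h4 := ValueDistribution.proximity_nonneg (f := f) (a := ⊤) (2 * r)
  have h5 := ValueDistribution.proximity_nonneg (f := f⁻¹) (a := ⊤) (2 * r)
  simp only [Pi.zero_apply] at h4 h5
  linarith

/-- `|log x| = log⁺ x + log⁺ x⁻¹` turns the mean into two proximity functions; the counting
functions are nonnegative for `r ≥ 1`. -/
theorem circleAverage_abs_log_norm_le {f : ℂ → ℂ} (hf : Meromorphic f) {r : ℝ} (hr : 1 ≤ r) :
    Real.circleAverage (fun z ↦ |Real.log ‖f z‖|) 0 r ≤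
      ValueDistribution.characteristic f ⊤ r + ValueDistribution.characteristic f⁻¹ ⊤ r := by
  have h1 : (fun z ↦ |Real.log ‖f z‖|) =
      fun z ↦ Real.posLog ‖f z‖ + Real.posLog ‖f⁻¹ z‖ := by
    ext z
    simp only [Pi.inv_apply, norm_inv]
    rcases le_total 0 (Real.log ‖f z‖) with h | h
    · rw [abs_of_nonneg h]; simp [Real.posLog, h]
    · rw [abs_of_nonpos h]; simp [Real.posLog, h]
  rw [h1, Real.circleAverage_fun_add hf.meromorphicOn.circleIntegrable_posLog_norm
    hf.inv.meromorphicOn.circleIntegrable_posLog_norm]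
  simp only [ValueDistribution.characteristic, Pi.add_apply, ValueDistribution.proximity_top]
  have h4 : 0 ≤ ValueDistribution.logCounting f ⊤ r := ValueDistribution.logCounting_nonneg hr
  have h5 : 0 ≤ ValueDistribution.logCounting f⁻¹ ⊤ r := ValueDistribution.logCounting_nonneg hr
  linarith

/-- Jensen's formula, in the form of the first main theorem. -/
theorem characteristic_inv_le {f : ℂ → ℂ} (hf : Meromorphic f) {r : ℝ} (hr : r ≠ 0) :
    ValueDistribution.characteristic f⁻¹ ⊤ r ≤ ValueDistribution.characteristic f ⊤ r +
      |Real.log ‖meromorphicTrailingCoeffAt f 0‖| := by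
  have h := ValueDistribution.characteristic_sub_characteristic_inv_of_ne_zero hf hr
  linarith [neg_abs_le (Real.log ‖meromorphicTrailingCoeffAt f 0‖)]

/-! ### Averages of `1 / ‖z - u‖` over discs. -/

/-- In polar coordinates the area factor `y` cancels `y⁻¹`. -/
theorem integrableOn_norm_inv_ball {K : ℝ} :
    IntegrableOn (fun z : ℂ ↦ ‖z‖⁻¹) (Metric.ball 0 K) := by
  refine (integrableOn_fun_norm_addHaar volume (f := fun y : ℝ ↦ y⁻¹)).2 ?_
  rw [Complex.finrank_real_complex]
  refine (integrableOn_const (C := (1 : ℝ)) (by simp) (by simp)).congr_fun ?_ measurableSet_Ioo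
  intro y hy
  simp [hy.1.ne']

theorem setIntegral_norm_inv_ball {K : ℝ} (hK : 0 ≤ K) :
    ∫ z in Metric.ball (0 : ℂ) K, ‖z‖⁻¹ = 2 * Real.pi * K := by
  have h := integral_fun_norm_addHaar (volume : Measure ℂ)
    ((Set.Iio K).indicator (fun y : ℝ ↦ y⁻¹))
  have h1 : ∀ z : ℂ, (Set.Iio K).indicator (fun y : ℝ ↦ y⁻¹) ‖z‖ =
      (Metric.ball (0 : ℂ) K).indicator (fun z ↦ ‖z‖⁻¹) z := by
    intro z
    simp [Set.indicator]
  simp only [h1] at h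
  rw [integral_indicator measurableSet_ball] at h
  rw [h, Complex.finrank_real_complex]
  have h2 : ∫ y in Set.Ioi (0 : ℝ), y ^ (2 - 1) • (Set.Iio K).indicator (fun y : ℝ ↦ y⁻¹) y =
      ∫ y in Set.Ioi (0 : ℝ), (Set.Iio K).indicator (fun _ ↦ (1 : ℝ)) y := by
    refine setIntegral_congr_fun measurableSet_Ioi fun y hy ↦ ?_
    by_cases hyK : y < K <;> simp [hyK, (Set.mem_Ioi.1 hy).ne']
  rw [h2, setIntegral_indicator measurableSet_Iio, Set.Ioi_inter_Iio]
  simp [measureReal_def, hK, Complex.volume_ball]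
  ring

/-- The integral of `1 / ‖z - u‖` over a subset of a disc of radius `K` about `u`. -/
theorem setIntegral_norm_sub_inv_le {u : ℂ} {K : ℝ} (hK : 0 ≤ K) {s : Set ℂ}
    (hs : s ⊆ Metric.ball u K) :
    IntegrableOn (fun z ↦ ‖z - u‖⁻¹) s ∧ ∫ z in s, ‖z - u‖⁻¹ ≤ 2 * Real.pi * K := by
  have hpre : (fun z : ℂ ↦ z - u) ⁻¹' (Metric.ball 0 K) = Metric.ball u K := by
    ext z; simp [dist_eq_norm]
  have hmp := measurePreserving_sub_right (volume : Measure ℂ) u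
  have hemb := (MeasurableEquiv.subRight u).measurableEmbedding
  have h1 : IntegrableOn (fun z ↦ ‖z - u‖⁻¹) (Metric.ball u K) := by
    rw [← hpre]
    exact (hmp.integrableOn_comp_preimage hemb).2 integrableOn_norm_inv_ball
  refine ⟨h1.mono_set hs, ?_⟩
  have h2 := hmp.setIntegral_preimage_emb hemb (fun z ↦ ‖z‖⁻¹) (Metric.ball 0 K)
  rw [hpre] at h2
  rw [← setIntegral_norm_inv_ball hK, ← h2]
  exact setIntegral_mono_set h1 (Eventually.of_forall fun z ↦ by positivity)
    (LE.le.eventuallyLE hs)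

/-- In a disc some point, in a prescribed set of full measure, is far on average from given
points. -/
theorem exists_sum_mul_norm_sub_inv_le {s : Finset ℂ} {m : ℂ → ℝ} (hm : ∀ u ∈ s, 0 ≤ m u)
    {c : ℂ} {ρ K : ℝ} (hρ : 0 < ρ) (hs : ∀ u ∈ s, Metric.ball c ρ ⊆ Metric.ball u K)
    {p : ℂ → Prop} (hp : ∀ᵐ z, p z) :
    ∃ z ∈ Metric.ball c ρ, p z ∧
      ∑ u ∈ s, m u * ‖z - u‖⁻¹ ≤ (∑ u ∈ s, m u) * (2 * K / ρ ^ 2) := by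
  have hK : ∀ u ∈ s, 0 ≤ K := fun u hu ↦
    (Metric.pos_of_mem_ball (hs u hu (Metric.mem_ball_self hρ))).le
  have hvol : volume.real (Metric.ball c ρ) = ρ ^ 2 * Real.pi := by
    simp [measureReal_def, Complex.volume_ball, hρ.le]
  have hμ : volume.restrict (Metric.ball c ρ) ≠ 0 := by
    rw [Ne, Measure.restrict_eq_zero]
    exact (Metric.measure_ball_pos volume c hρ).ne'
  have hint : ∀ u ∈ s, IntegrableOn (fun z ↦ m u * ‖z - u‖⁻¹) (Metric.ball c ρ) := fun u hu ↦
    (setIntegral_norm_sub_inv_le (hK u hu) (hs u hu)).1.const_mul _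
  have hnull : volume.restrict (Metric.ball c ρ) {z | ¬ (z ∈ Metric.ball c ρ ∧ p z)} = 0 := by
    rw [← ae_iff]
    filter_upwards [ae_restrict_mem measurableSet_ball, ae_restrict_of_ae hp] with z h1 h2
      using ⟨h1, h2⟩
  have : IsFiniteMeasure (volume.restrict (Metric.ball c ρ)) :=
    ⟨by simpa using measure_ball_lt_top (μ := volume) (x := c)⟩
  -- Off the null set of bad points, some value is at most the average; each `‖z - u‖⁻¹` averages to
  -- at most `2πK / (πρ²)`.
  obtain ⟨z, hz, hle⟩ := exists_notMem_null_le_average hμ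
    (integrable_finsetSum s hint) hnull
  have hz' : z ∈ Metric.ball c ρ ∧ p z := by simpa using hz
  refine ⟨z, hz'.1, hz'.2, hle.trans ?_⟩
  rw [average_eq, integral_finsetSum s hint, measureReal_restrict_apply_univ, hvol, smul_eq_mul,
    Finset.sum_mul, Finset.mul_sum]
  refine Finset.sum_le_sum fun u hu ↦ ?_
  rw [integral_const_mul]
  have h := (setIntegral_norm_sub_inv_le (hK u hu) (hs u hu)).2
  calc (ρ ^ 2 * Real.pi)⁻¹ * (m u * ∫ z in Metric.ball c ρ, ‖z - u‖⁻¹)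
      ≤ (ρ ^ 2 * Real.pi)⁻¹ * (m u * (2 * Real.pi * K)) := by
        gcongr
        exact hm u hu
    _ = m u * (2 * K / ρ ^ 2) := by
        field_simp

/-! ### Local factorization and comparison of translates. -/

/-- On a disc, a meromorphic function is a rational function times an exponential, with the data
controlled by the Nevanlinna characteristic. -/
theorem exists_eq_prod_mul_exp {f : ℂ → ℂ} (hf : Meromorphic f)
    (hord : ∀ z, meromorphicOrderAt f z ≠ ⊤) {R : ℝ} (hR : 1 ≤ R) :
    ∃ (s : Finset ℂ) (d : ℂ → ℤ) (G : ℂ → ℂ),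
      (∀ u ∈ s, ‖u‖ ≤ 2 * R) ∧
      (∑ u ∈ s, |(d u : ℝ)|) * Real.log 2 ≤
        ValueDistribution.characteristic f ⊤ (4 * R) +
          ValueDistribution.characteristic f⁻¹ ⊤ (4 * R) ∧
      DifferentiableOn ℂ G (Metric.ball 0 (2 * R)) ∧
      Real.circleAverage (fun z ↦ |(G z).re|) 0 R ≤
        ValueDistribution.characteristic f ⊤ R + ValueDistribution.characteristic f⁻¹ ⊤ R +
          (∑ u ∈ s, |(d u : ℝ)|) * (2 * Real.log (3 * R)) ∧
      ∀ᵐ w, w ∈ Metric.ball (0 : ℂ) (2 * R) →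
        (∀ u ∈ s, w ≠ u) ∧ f w = (∏ u ∈ s, (w - u) ^ d u) * Complex.exp (G w) := by
  have hR0 : 0 < R := by linarith
  -- The radius `2R` keeps `G` holomorphic across the circle `|z| = R`; counting points there costs
  -- the characteristic at `4R`.
  set U := Metric.closedBall (0 : ℂ) (2 * R) with hU
  set D := MeromorphicOn.divisor f U with hD
  have hfin : D.support.Finite := D.finiteSupport (isCompact_closedBall 0 _)
  obtain ⟨g, hg, hg₀, hfg⟩ := MeromorphicOn.extract_zeros_poles (U := U) hf.meromorphicOn
    (fun u ↦ hord u) hfin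
  have hball : Metric.ball (0 : ℂ) (2 * R) ⊆ U := Metric.ball_subset_closedBall
  obtain ⟨G, hGd, hG⟩ := exists_eq_exp_on_ball (c := 0) (R := 2 * R) (by positivity)
    (fun w hw ↦ (hg w (hball hw)).differentiableAt.differentiableWithinAt)
    (fun w hw ↦ hg₀ ⟨w, hball hw⟩)
  have hDu : ∀ u ∈ hfin.toFinset, u ∈ U := fun u hu ↦
    D.supportWithinDomain (hfin.mem_toFinset.1 hu)
  have hs : ∀ u ∈ hfin.toFinset, ‖u‖ ≤ 2 * R := fun u hu ↦ by simpa [hU] using hDu u hu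
  have hlogf := MeromorphicOn.extract_zeros_poles_log hg₀ hfg
  have hsum : (∑ᶠ u, (D u * Real.log ‖· - u‖) : ℂ → ℝ) =
      fun z ↦ ∑ u ∈ hfin.toFinset, (D u : ℝ) * Real.log ‖z - u‖ := by
    rw [finsum_eq_sum_of_support_subset (s := hfin.toFinset)]
    · ext z; simp
    · intro u hu
      rw [Set.Finite.coe_toFinset, Function.mem_support]
      intro h0
      refine hu ?_
      ext z
      simp [h0]
  rw [hsum] at hlogf
  have hsph : Metric.sphere (0 : ℂ) |R| ⊆ U := by
    rw [abs_of_pos hR0]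
    exact Metric.sphere_subset_closedBall.trans (Metric.closedBall_subset_closedBall (by linarith))
  refine ⟨hfin.toFinset, D, G, hs, ?_, hGd, ?_, ?_⟩
  · have h := sum_abs_divisor_mul_log_two_le (f := f) (r := 2 * R) (by linarith) hs
    rw [show 2 * (2 * R) = 4 * R by ring] at h
    refine le_of_eq_of_le ?_ h
    congr 1
    refine Finset.sum_congr rfl fun u hu ↦ ?_
    rw [hD, MeromorphicOn.divisor_apply hf.meromorphicOn (hDu u hu),
      MeromorphicOn.divisor_apply hf.meromorphicOn (Set.mem_univ u)]
  · have hGre : ∀ z ∈ Metric.sphere (0 : ℂ) |R|, (G z).re = Real.log ‖g z‖ := by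
      intro z hz
      rw [hG z ?_, Complex.norm_exp, Real.log_exp]
      rw [abs_of_pos hR0, mem_sphere_zero_iff_norm] at hz
      rw [mem_ball_zero_iff]
      linarith
    have h1 : CircleIntegrable (fun z ↦ |Real.log ‖f z‖|) 0 R :=
      (MeromorphicOn.circleIntegrable_log_norm hf.meromorphicOn).abs
    have h2 : ∀ u ∈ hfin.toFinset,
        CircleIntegrable (fun z ↦ |(D u : ℝ)| * |Real.log ‖z - u‖|) 0 R := fun u _ ↦
      (MeromorphicOn.circleIntegrable_log_norm (f := fun z ↦ z - u)
        (fun z _ ↦ by fun_prop)).abs.const_smul (a := |(D u : ℝ)|)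
    have h3 : CircleIntegrable (fun z ↦ ∑ u ∈ hfin.toFinset,
        |(D u : ℝ)| * |Real.log ‖z - u‖|) 0 R := CircleIntegrable.fun_sum _ h2
    have hmg : MeromorphicOn g (Metric.sphere 0 |R|) := fun z hz ↦ (hg z (hsph hz)).meromorphicAt
    have h4 : Real.circleAverage (fun z ↦ |(G z).re|) 0 R =
        Real.circleAverage (fun z ↦ |Real.log ‖f z‖ -
          ∑ u ∈ hfin.toFinset, (D u : ℝ) * Real.log ‖z - u‖|) 0 R := by
      refine Real.circleAverage_congr_codiscreteWithin ?_ hR0.ne'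
      filter_upwards [hlogf.filter_mono (codiscreteWithin_mono hsph),
        self_mem_codiscreteWithin _] with z hz1 hz2
      rw [hGre z hz2, hz1]
      simp
    have h5 : CircleIntegrable (fun z ↦ Real.log ‖f z‖ -
          ∑ u ∈ hfin.toFinset, (D u : ℝ) * Real.log ‖z - u‖) 0 R :=
      (MeromorphicOn.circleIntegrable_log_norm hf.meromorphicOn).sub
        (CircleIntegrable.fun_sum _ fun u _ ↦ (MeromorphicOn.circleIntegrable_log_norm
          (f := fun z ↦ z - u) (fun z _ ↦ by fun_prop)).const_smul (a := (D u : ℝ)))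
    rw [h4]
    calc _ ≤ Real.circleAverage (fun z ↦ |Real.log ‖f z‖| +
            ∑ u ∈ hfin.toFinset, |(D u : ℝ)| * |Real.log ‖z - u‖|) 0 R := by
          refine Real.circleAverage_mono h5.abs (h1.add h3) fun z _ ↦ ?_
          refine (abs_sub _ _).trans ?_
          gcongr
          refine (Finset.abs_sum_le_sum_abs _ _).trans_eq ?_
          simp only [abs_mul]
      _ = Real.circleAverage (fun z ↦ |Real.log ‖f z‖|) 0 R + ∑ u ∈ hfin.toFinset,
            |(D u : ℝ)| * Real.circleAverage (fun z ↦ |Real.log ‖z - u‖|) 0 R := by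
          rw [Real.circleAverage_fun_add h1 h3, Real.circleAverage_fun_sum h2]
          congr 1
          refine Finset.sum_congr rfl fun u _ ↦ ?_
          exact Real.circleAverage_fun_smul (a := |(D u : ℝ)|)
      _ ≤ _ := by
          rw [Finset.sum_mul]
          refine add_le_add (circleAverage_abs_log_norm_le hf hR) (Finset.sum_le_sum fun u hu ↦ ?_)
          gcongr
          exact circleAverage_abs_log_norm_sub_le hR (hs u hu)
  · have hae := (ae_restrict_iff' (μ := volume) Metric.isClosed_closedBall.measurableSet).1
      (ae_restrict_le_codiscreteWithin (μ := (volume : Measure ℂ))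
      Metric.isClosed_closedBall.measurableSet hfg)
    have hsf : ∀ᵐ w : ℂ, w ∉ (hfin.toFinset : Set ℂ) :=
      measure_eq_zero_iff_ae_notMem.1 ((Finset.finite_toSet _).measure_zero _)
    filter_upwards [hae, hsf] with w hw hws hwb
    refine ⟨fun u hu h ↦ hws (by rw [h]; exact hu), ?_⟩
    rw [← hD] at hw
    rw [hw (hball hwb)]
    rw [finprod_eq_prod_of_mulSupport_subset (s := hfin.toFinset)]
    · simp [hG w hwb]
    · simp [Function.FactorizedRational.mulSupport]

/-- The exponents are integers, so the branch of the logarithm is immaterial. -/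
theorem exp_sum_mul_log_eq_prod_zpow {s : Finset ℂ} {d : ℂ → ℤ} {z w : ℂ}
    (hz : ∀ u ∈ s, z ≠ u) (hzw : ∀ u ∈ s, z + w ≠ u) :
    ∏ u ∈ s, (z + w - u) ^ d u =
      (∏ u ∈ s, (z - u) ^ d u) *
        Complex.exp (∑ u ∈ s, d u * Complex.log (1 + w / (z - u))) := by
  rw [Complex.exp_sum, ← Finset.prod_mul_distrib]
  refine Finset.prod_congr rfl fun u hu ↦ ?_
  have h1 : z - u ≠ 0 := sub_ne_zero.2 (hz u hu)
  have h2 : 1 + w / (z - u) = (z + w - u) / (z - u) := by field_simp; ring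
  have h3 : z + w - u ≠ 0 := sub_ne_zero.2 (hzw u hu)
  rw [Complex.exp_int_mul, h2, Complex.exp_log (div_ne_zero h3 h1), div_zpow,
    mul_div_cancel₀ _ (zpow_ne_zero _ h1)]

theorem norm_sum_mul_log_le {s : Finset ℂ} {d : ℂ → ℤ} {z w : ℂ} {B : ℝ}
    (hB : ‖w‖ * ∑ u ∈ s, |(d u : ℝ)| * ‖z - u‖⁻¹ ≤ B) (hB' : B ≤ 1 / 2) :
    ‖∑ u ∈ s, d u * Complex.log (1 + w / (z - u))‖ ≤ 3 / 2 * B := by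
  have hterm : ∀ u ∈ s, ‖(d u : ℂ) * Complex.log (1 + w / (z - u))‖ ≤
      3 / 2 * (‖w‖ * (|(d u : ℝ)| * ‖z - u‖⁻¹)) := by
    intro u hu
    rcases eq_or_ne (d u) 0 with h0 | h0
    · simp [h0]
    -- A nonzero multiplicity is at least 1, so the bound on the weighted sum forces `‖w / (z - u)‖
    -- ≤ 1 / 2`, where `log (1 + x)` is controlled by `x`.
    have hd1 : (1 : ℝ) ≤ |(d u : ℝ)| := by
      rw [← Int.cast_abs]
      exact_mod_cast Int.one_le_abs h0
    have hle : ‖w‖ * (|(d u : ℝ)| * ‖z - u‖⁻¹) ≤ B := by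
      refine le_trans ?_ hB
      gcongr
      exact Finset.single_le_sum (f := fun u ↦ |(d u : ℝ)| * ‖z - u‖⁻¹)
        (fun i _ ↦ by positivity) hu
    have hw : ‖w / (z - u)‖ ≤ 1 / 2 := by
      rw [norm_div, div_eq_mul_inv]
      refine le_trans ?_ (hle.trans hB')
      gcongr
      exact le_mul_of_one_le_left (by positivity) hd1
    rw [norm_mul, Complex.norm_intCast]
    calc |(d u : ℝ)| * ‖Complex.log (1 + w / (z - u))‖
        ≤ |(d u : ℝ)| * (3 / 2 * ‖w / (z - u)‖) := by
          gcongr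
          exact Complex.norm_log_one_add_half_le_self hw
      _ = _ := by rw [norm_div, div_eq_mul_inv]; ring
  calc _ ≤ ∑ u ∈ s, 3 / 2 * (‖w‖ * (|(d u : ℝ)| * ‖z - u‖⁻¹)) := norm_sum_le_of_le _ hterm
    _ = 3 / 2 * (‖w‖ * ∑ u ∈ s, |(d u : ℝ)| * ‖z - u‖⁻¹) := by
        rw [Finset.mul_sum, Finset.mul_sum]
    _ ≤ _ := by gcongr

/-- Quantitative comparison of the values of a meromorphic function at a suitable point and at its
translates. -/
theorem exists_forall_eq_mul_exp {f : ℂ → ℂ} (hf : Meromorphic f)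
    (hord : ∀ z, meromorphicOrderAt f z ≠ ⊤) {R N A : ℝ} (hR : 1 ≤ R)
    (hN : ValueDistribution.characteristic f ⊤ (4 * R) +
      ValueDistribution.characteristic f⁻¹ ⊤ (4 * R) ≤ N * Real.log 2)
    (hA : ValueDistribution.characteristic f ⊤ R + ValueDistribution.characteristic f⁻¹ ⊤ R +
      N * (2 * Real.log (3 * R)) ≤ A) (hA₀ : 0 < A)
    (η : ℂ) (n : ℕ) (hηR : n * ‖η‖ ≤ R / 8) (hηN : n * ‖η‖ * (2048 * N / R) ≤ 1 / 2)
    {p : ℂ → Prop} (hp : ∀ᵐ z, p z) :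
    ∃ z : ℂ, R / 16 ≤ ‖z‖ ∧ p z ∧ f z ≠ 0 ∧ ∀ j ≤ n, ∃ E : ℂ,
      ‖E‖ ≤ n * ‖η‖ * (3072 * (N / R) + 96 * (A / R)) ∧ f (z + j * η) = f z * Complex.exp E := by
  have hR0 : 0 < R := by linarith
  obtain ⟨s, d, G, hs, hsN, hGd, hGA, hfG⟩ := exists_eq_prod_mul_exp hf hord hR
  have hN' : ∑ u ∈ s, |(d u : ℝ)| ≤ N :=
    le_of_mul_le_mul_right (hsN.trans hN) (Real.log_pos one_lt_two)
  have hlog : 0 ≤ Real.log (3 * R) := Real.log_nonneg (by linarith)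
  have hGA' : Real.circleAverage (fun z ↦ |(G z).re|) 0 R ≤ A := by
    refine hGA.trans (le_trans ?_ hA)
    gcongr
  have hshift : ∀ᵐ z : ℂ, ∀ j : ℕ, z + j * η ∈ Metric.ball (0 : ℂ) (2 * R) →
      (∀ u ∈ s, z + j * η ≠ u) ∧ f (z + j * η) =
        (∏ u ∈ s, (z + j * η - u) ^ d u) * Complex.exp (G (z + j * η)) := by
    rw [ae_all_iff]
    intro j
    exact (measurePreserving_add_right (volume : Measure ℂ) (j * η)).quasiMeasurePreserving.ae hfG
  have hcen : ‖((R / 8 : ℝ) : ℂ)‖ = R / 8 := by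
    rw [Complex.norm_real, Real.norm_eq_abs, abs_of_pos (by positivity)]
  have hzb : ∀ z ∈ Metric.ball ((R / 8 : ℝ) : ℂ) (R / 16), R / 16 ≤ ‖z‖ ∧ ‖z‖ ≤ R / 4 := by
    intro z hz
    rw [mem_ball_iff_norm] at hz
    have h1 := norm_sub_norm_le ((R / 8 : ℝ) : ℂ) z
    have h2 := norm_sub_norm_le z ((R / 8 : ℝ) : ℂ)
    rw [norm_sub_rev] at h1
    constructor <;> linarith
  -- The disc of radius `R / 16` about `R / 8` lies in `R / 16 ≤ ‖z‖ ≤ R / 4`: far out, yet within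
  -- reach of the bound on `G`. There `‖z - u‖ < 4R`, and `2 * 4R / (R / 16)² = 2048 / R`.
  obtain ⟨z, hz, ⟨hzp, hzs⟩, hsum⟩ := exists_sum_mul_norm_sub_inv_le
    (s := s) (m := fun u ↦ |(d u : ℝ)|) (fun u _ ↦ abs_nonneg _) (c := ((R / 8 : ℝ) : ℂ))
    (ρ := R / 16) (K := 4 * R) (by positivity) (fun u hu z hz ↦ by
      rw [mem_ball_iff_norm]
      linarith [norm_sub_le z u, hs u hu, (hzb z hz).2]) (hp.and hshift)
  obtain ⟨hz1, hz2⟩ := hzb z hz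
  have hsum' : ∑ u ∈ s, |(d u : ℝ)| * ‖z - u‖⁻¹ ≤ 2048 * N / R := by
    refine hsum.trans ?_
    have h : 2 * (4 * R) / (R / 16) ^ 2 = 2048 / R := by field_simp; norm_num
    rw [h, mul_comm, mul_div_right_comm]
    gcongr
  have hz0 := hzs 0 (by rw [mem_ball_zero_iff]; simp; linarith)
  simp only [Nat.cast_zero, zero_mul, add_zero] at hz0
  refine ⟨z, hz1, hzp, ?_, fun j hj ↦ ?_⟩
  · rw [hz0.2]
    exact mul_ne_zero (Finset.prod_ne_zero_iff.2 fun u hu ↦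
      zpow_ne_zero _ (sub_ne_zero.2 (hz0.1 u hu))) (Complex.exp_ne_zero _)
  · have hjη : ‖(j : ℂ) * η‖ ≤ n * ‖η‖ := by
      rw [norm_mul, Complex.norm_natCast]
      gcongr
    obtain ⟨hj1, hj2⟩ := hzs j (by
      rw [mem_ball_zero_iff]
      linarith [norm_add_le z (j * η)])
    refine ⟨∑ u ∈ s, d u * Complex.log (1 + (j * η) / (z - u)) + (G (z + j * η) - G z), ?_, ?_⟩
    · have h1 := norm_sum_mul_log_le (s := s) (d := d) (z := z) (w := j * η)
        (mul_le_mul hjη hsum' (Finset.sum_nonneg fun u _ ↦ by positivity) (by positivity)) hηN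
      have h2 := norm_sub_le_of_circleAverage_abs_re_le hR0 (by linarith : R < 2 * R) hGd hA₀ hGA'
        hz2 (hjη.trans hηR)
      have h3 : 96 * A * ‖(j : ℂ) * η‖ / R ≤ 96 * A * (n * ‖η‖) / R := by gcongr
      calc _ ≤ _ := norm_add_le _ _
        _ ≤ 3 / 2 * (n * ‖η‖ * (2048 * N / R)) + 96 * A * (n * ‖η‖) / R :=
          add_le_add h1 (h2.trans h3)
        _ = _ := by ring
    · rw [hj2, hz0.2, exp_sum_mul_log_eq_prod_zpow hz0.1 hj1, Complex.exp_add, Complex.exp_sub]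
      have := Complex.exp_ne_zero (G z)
      field_simp

/-! ### Functions of order less than one. -/

theorem ae_of_eventually_codiscrete {p : ℂ → Prop} (h : ∀ᶠ z in codiscrete ℂ, p z) :
    ∀ᵐ z, p z := by
  have := ae_restrict_le_codiscreteWithin (μ := (volume : Measure ℂ)) MeasurableSet.univ h
  rwa [Measure.restrict_univ] at this

/-- By the identity theorem, infinite order at one point propagates to all points, and `f` then
vanishes off a discrete set. -/
theorem meromorphicOrderAt_ne_top_of_not_eventuallyEq_zero {f : ℂ → ℂ} (hf : Meromorphic f)
    (hf₀ : ¬ f =ᶠ[codiscrete ℂ] 0) (z : ℂ) : meromorphicOrderAt f z ≠ ⊤ := by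
  refine hf.exists_meromorphicOrderAt_ne_top_iff_forall.1 ?_ z
  by_contra! h
  refine hf₀ ?_
  rw [Filter.EventuallyEq, Filter.Eventually, mem_codiscrete]
  intro x
  rw [Filter.disjoint_principal_right, compl_compl]
  exact meromorphicOrderAt_eq_top_iff.1 (h x)

theorem eventually_characteristic_le_rpow {f : ℂ → ℂ} (h : nevanlinnaOrder f < 1) :
    ∃ α : ℝ, 0 ≤ α ∧ α < 1 ∧
      ∀ᶠ r in atTop, ValueDistribution.characteristic f ⊤ r ≤ r ^ α := by
  obtain ⟨α, h1, h2⟩ := EReal.lt_iff_exists_real_btwn.1 h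
  have h2' : α < 1 := by exact_mod_cast h2
  -- A nonnegative exponent makes constants `O(r^α)`.
  refine ⟨max α 0, le_max_right _ _, max_lt h2' one_pos, ?_⟩
  filter_upwards [eventually_lt_of_limsup_lt h1, eventually_gt_atTop 1] with r hr hr1
  have hlog : 0 < Real.log r := Real.log_pos hr1
  rw [EReal.coe_lt_coe_iff, div_lt_iff₀ hlog] at hr
  have hT : ValueDistribution.characteristic f ⊤ r ≤
      Real.exp (Real.posLog (ValueDistribution.characteristic f ⊤ r)) := by
    refine (Real.le_exp_log _).trans (Real.exp_le_exp.2 ?_)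
    exact le_max_right _ _
  refine hT.trans ?_
  rw [Real.rpow_def_of_pos (by linarith)]
  refine Real.exp_le_exp.2 (hr.le.trans ?_)
  rw [mul_comm]
  gcongr
  exact le_max_left _ _

/-- A meromorphic function of order less than one is almost invariant under finitely many
translations, at suitable points near infinity. -/
theorem exists_forall_eq_mul_exp_of_nevanlinnaOrder_lt_one {f : ℂ → ℂ} (hf : Meromorphic f)
    (hf₀ : ¬ f =ᶠ[codiscrete ℂ] 0) (hord : nevanlinnaOrder f < 1) (η : ℂ) (n : ℕ)
    {ε : ℝ} (hε : 0 < ε) (r₀ : ℝ) {p : ℂ → Prop} (hp : ∀ᵐ z, p z) :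
    ∃ z : ℂ, r₀ ≤ ‖z‖ ∧ p z ∧ f z ≠ 0 ∧ ∀ j ≤ n, ∃ E : ℂ,
      ‖E‖ ≤ ε ∧ f (z + j * η) = f z * Complex.exp E := by
  obtain ⟨α, hα₀, hα₁, hα⟩ := eventually_characteristic_le_rpow hord
  set C := |Real.log ‖meromorphicTrailingCoeffAt f 0‖|
  -- `N` and `A` are the bounds required by `exists_forall_eq_mul_exp` once `T(r, f) ≤ r^α`; `C` is
  -- the cost of passing to `f⁻¹`, and the final `+ 1` in `A` makes it positive.
  set N : ℝ → ℝ := fun R ↦ (2 * (4 * R) ^ α + C) / Real.log 2 with hN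
  set A : ℝ → ℝ := fun R ↦ 2 * R ^ α + C + N R * (2 * Real.log (3 * R)) + 1 with hA
  have hC : ∀ c : ℝ, (fun _ : ℝ ↦ c) =o[atTop] (fun R : ℝ ↦ R) := fun c ↦
    isLittleO_const_id_atTop c
  have hrpow : (fun R : ℝ ↦ R ^ α) =o[atTop] (fun R : ℝ ↦ R) := by
    refine (isLittleO_iff_tendsto' ?_).2 ?_
    · filter_upwards [eventually_ne_atTop 0] with R hR h using absurd h hR
    · refine (tendsto_rpow_neg_atTop (sub_pos.2 hα₁)).congr' ?_
      filter_upwards [eventually_gt_atTop 0] with R hR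
      rw [neg_sub, Real.rpow_sub_one hR.ne']
  have hone : (fun _ : ℝ ↦ (1 : ℝ)) =O[atTop] (fun R : ℝ ↦ R ^ α) := by
    refine IsBigO.of_bound 1 ?_
    filter_upwards [eventually_ge_atTop 1] with R hR
    have := Real.one_le_rpow hR hα₀
    simpa using this.trans (le_abs_self _)
  have hNO : N =O[atTop] (fun R : ℝ ↦ R ^ α) := by
    have h1 : (fun R : ℝ ↦ 2 * (4 : ℝ) ^ α * R ^ α) =O[atTop] (fun R : ℝ ↦ R ^ α) :=
      (isBigO_refl _ _).const_mul_left _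
    have h2 : (fun R : ℝ ↦ (4 * R) ^ α * 2) =ᶠ[atTop] fun R ↦ 2 * (4 : ℝ) ^ α * R ^ α := by
      filter_upwards [eventually_ge_atTop 0] with R hR
      rw [Real.mul_rpow (by norm_num) hR]; ring
    have h3 := ((h2.trans_isBigO h1).add (hone.const_mul_left C)).const_mul_left (Real.log 2)⁻¹
    refine h3.congr_left fun R ↦ ?_
    simp only [hN, div_eq_inv_mul]
    ring
  have hlogo : (fun R : ℝ ↦ 2 * Real.log (3 * R)) =o[atTop] (fun R : ℝ ↦ R ^ (1 - α)) := by
    have hd : 0 < 1 - α := by linarith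
    have h1 : (fun _ : ℝ ↦ Real.log 3) =o[atTop] (fun R : ℝ ↦ R ^ (1 - α)) :=
      isLittleO_const_left.2 (Or.inr (tendsto_norm_atTop_atTop.comp (tendsto_rpow_atTop hd)))
    refine ((h1.add (isLittleO_log_rpow_atTop hd)).const_mul_left 2).congr' ?_ EventuallyEq.rfl
    filter_upwards [eventually_gt_atTop 0] with R hR
    rw [Real.log_mul (by norm_num) hR.ne']
  -- `O(R^α) * o(R^(1 - α)) = o(R)`: the logarithm is absorbed because `α < 1`.
  have hNlog : (fun R ↦ N R * (2 * Real.log (3 * R))) =o[atTop] (fun R : ℝ ↦ R) := by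
    refine (hNO.mul_isLittleO hlogo).congr' EventuallyEq.rfl ?_
    filter_upwards [eventually_gt_atTop 0] with R hR
    rw [← Real.rpow_add hR]
    simp
  have hAo : A =o[atTop] (fun R : ℝ ↦ R) :=
    (((hrpow.const_mul_left 2).add (hC C)).add hNlog).add (hC 1)
  have hNt : Tendsto (fun R ↦ N R / R) atTop (nhds 0) :=
    (hNO.trans_isLittleO hrpow).tendsto_div_nhds_zero
  have hAt : Tendsto (fun R ↦ A R / R) atTop (nhds 0) := hAo.tendsto_div_nhds_zero
  have hEt : Tendsto (fun R ↦ n * ‖η‖ * (3072 * (N R / R) + 96 * (A R / R))) atTop (nhds 0) := by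
    simpa using ((hNt.const_mul 3072).add (hAt.const_mul 96)).const_mul (n * ‖η‖)
  have hNt' : Tendsto (fun R ↦ n * ‖η‖ * (2048 * (N R / R))) atTop (nhds 0) := by
    simpa using (hNt.const_mul 2048).const_mul (n * ‖η‖)
  have hα4 := (tendsto_id.const_mul_atTop (show (0 : ℝ) < 4 by norm_num)).eventually hα
  obtain ⟨R, hR1, hR2, hR3, hR4, hR5, hR6, hR7⟩ :=
    (hα.and (hα4.and ((hEt.eventually_lt_const hε).and
      ((hNt'.eventually_lt_const one_half_pos).and ((eventually_ge_atTop (1 : ℝ)).and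
        ((eventually_ge_atTop (8 * (n * ‖η‖))).and (eventually_ge_atTop (16 * r₀)))))))).exists
  simp only [id] at hR2
  have hI1 := characteristic_inv_le hf (r := R) (by positivity)
  have hI4 := characteristic_inv_le hf (r := 4 * R) (by positivity)
  have hlog2 : 0 < Real.log 2 := Real.log_pos one_lt_two
  have hN0 : 0 ≤ N R := by positivity
  have hlog3 : 0 ≤ Real.log (3 * R) := Real.log_nonneg (by linarith)
  obtain ⟨z, hz1, hz2, hz3, hz4⟩ := exists_forall_eq_mul_exp hf
    (meromorphicOrderAt_ne_top_of_not_eventuallyEq_zero hf hf₀) (R := R) (N := N R) (A := A R) hR5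
    (by
      simp only [hN]
      rw [div_mul_cancel₀ _ hlog2.ne']
      linarith)
    (by simp only [hA]; linarith) (by positivity) η n (by linarith)
    (by rw [mul_div_assoc]; exact hR4.le) hp
  refine ⟨z, by linarith, hz2, hz3, fun j hj ↦ ?_⟩
  obtain ⟨E, hE, hEf⟩ := hz4 j hj
  exact ⟨E, hE.trans hR3.le, hEf⟩

/-! ### The difference equation. -/

/-- For `j ≠ 0` the signed binomial coefficients sum to 0, so `f z` may be subtracted from each
translate. Each increment is at most `2ε‖f z‖`, as `‖exp E - 1‖ ≤ 2‖E‖` for `‖E‖ ≤ 1`, and the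
absolute coefficients sum to `2^j`. -/
theorem norm_fwdDiff_iter_le {f : ℂ → ℂ} {η z : ℂ} {n j : ℕ} (hj : j ≠ 0) (hjn : j ≤ n) {ε : ℝ}
    (hε : ε ≤ 1)
    (h : ∀ k ≤ n, ∃ E : ℂ, ‖E‖ ≤ ε ∧ f (z + k * η) = f z * Complex.exp E) :
    ‖(fwdDiff η)^[j] f z‖ ≤ 2 ^ j * (2 * ε * ‖f z‖) := by
  have hzero : ∑ k ∈ Finset.range (j + 1), (((-1 : ℤ) ^ (j - k) * j.choose k : ℤ) : ℂ) = 0 := by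
    rw [← Int.cast_sum, Int.cast_eq_zero]
    have := add_pow (1 : ℤ) (-1) j
    simpa [hj] using this.symm
  have heq : (fwdDiff η)^[j] f z = ∑ k ∈ Finset.range (j + 1),
      (((-1 : ℤ) ^ (j - k) * j.choose k : ℤ) : ℂ) * (f (z + k * η) - f z) := by
    simp only [mul_sub, Finset.sum_sub_distrib]
    rw [← Finset.sum_mul, hzero, zero_mul, sub_zero, fwdDiff_iter_eq_sum_shift]
    simp only [zsmul_eq_mul, nsmul_eq_mul]
  have hterm : ∀ k ∈ Finset.range (j + 1),
      ‖(((-1 : ℤ) ^ (j - k) * j.choose k : ℤ) : ℂ) * (f (z + k * η) - f z)‖ ≤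
        (j.choose k : ℝ) * (2 * ε * ‖f z‖) := by
    intro k hk
    obtain ⟨E, hE, hEf⟩ := h k ((Nat.lt_succ_iff.1 (Finset.mem_range.1 hk)).trans hjn)
    rw [norm_mul]
    have h1 : ‖(((-1 : ℤ) ^ (j - k) * j.choose k : ℤ) : ℂ)‖ = j.choose k := by
      simp
    have h2 : f (z + k * η) - f z = (Complex.exp E - 1) * f z := by rw [hEf]; ring
    rw [h1, h2, norm_mul]
    gcongr
    exact (Complex.norm_exp_sub_one_le (hE.trans hε)).trans (by linarith)
  rw [heq]
  refine (norm_sum_le_of_le _ hterm).trans_eq ?_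
  rw [← Finset.sum_mul]
  congr 1
  exact_mod_cast Nat.sum_range_choose j

/-- Values at isolated points carry no meaning for a meromorphic function, so identities are read on
codiscrete sets. -/
theorem theorem7p1 (η : ℂ) (hη : η ≠ 0) (n : ℕ) (P : ℕ → ℂ[X]) (hP₀ : P 0 ≠ 0)
    (hdeg : ∀ j : ℕ, 1 ≤ j → j ≤ n → (P j).degree ≤ (P 0).degree)
    (f : ℂ → ℂ) (hf : Meromorphic f) (hf₀ : ¬ f =ᶠ[codiscrete ℂ] 0)
    (hsol : ∀ᶠ z in codiscrete ℂ,
      ∑ j ∈ Finset.range (n + 1), (P j).eval z * (fwdDiff η)^[j] f z = 0) :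
    1 ≤ nevanlinnaOrder f := by
  by_contra! hord
  obtain ⟨C, hC, hCP⟩ : ∃ C : ℝ, 0 < C ∧ ∀ᶠ z in Bornology.cobounded ℂ,
      ∀ j ∈ Finset.Icc 1 n, ‖(P j).eval z‖ ≤ C * ‖(P 0).eval z‖ := by
    have h : ∀ j ∈ Finset.Icc 1 n, ∃ c : ℝ, ∀ᶠ z in Bornology.cobounded ℂ,
        ‖(P j).eval z‖ ≤ c * ‖(P 0).eval z‖ := fun j hj ↦
      (isBigO_cobounded_of_degree_le (hdeg j (Finset.mem_Icc.1 hj).1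
        (Finset.mem_Icc.1 hj).2)).bound
    choose! c hc using h
    refine ⟨1 + ∑ j ∈ Finset.Icc 1 n, |c j|, by positivity, ?_⟩
    refine (Finset.eventually_all _).2 fun j hj ↦ ?_
    filter_upwards [hc j hj] with z hz
    refine hz.trans ?_
    gcongr
    have := Finset.single_le_sum (f := fun j ↦ |c j|) (fun i _ ↦ abs_nonneg _) hj
    linarith [le_abs_self (c j)]
  obtain ⟨r₀, -, hr₀⟩ := (Filter.hasBasis_cobounded_norm (E := ℂ)).eventually_iff.1 hCP
  have hroot : ∀ᵐ z : ℂ, (P 0).eval z ≠ 0 :=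
    measure_eq_zero_iff_ae_notMem.1 ((finite_setOfPred_isRoot hP₀).measure_zero volume)
  -- The `n` terms with `j ≥ 1` total at most `2Cn2^n δ` times `‖P₀(z) f(z)‖`, and this `δ` makes
  -- the factor less than 1. The `+ 1` in the denominator gives `δ ≤ 1`.
  set δ : ℝ := 1 / (4 * (C * (n + 1) * 2 ^ n) + 1) with hδ
  have hK : 0 < C * (n + 1) * 2 ^ n := by positivity
  have hδ0 : 0 < δ := by positivity
  have hδ1 : δ ≤ 1 := by
    rw [hδ, div_le_one (by positivity)]; linarith
  obtain ⟨z, hz1, ⟨hz2, hz3⟩, hz4, hz5⟩ := exists_forall_eq_mul_exp_of_nevanlinnaOrder_lt_one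
    hf hf₀ hord η n hδ0 r₀ (hroot.and (ae_of_eventually_codiscrete hsol))
  rw [Finset.sum_range_succ', Function.iterate_zero_apply] at hz3
  have hterm : ∀ j ∈ Finset.range n, ‖(P (j + 1)).eval z * (fwdDiff η)^[j + 1] f z‖ ≤
      C * ‖(P 0).eval z‖ * (2 ^ n * (2 * δ * ‖f z‖)) := by
    intro j hj
    have hj' : j + 1 ≤ n := Finset.mem_range.1 hj
    rw [norm_mul]
    gcongr
    · exact hr₀ hz1 _ (Finset.mem_Icc.2 ⟨by omega, hj'⟩)
    · refine (norm_fwdDiff_iter_le (by omega) hj' hδ1 hz5).trans ?_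
      gcongr
      norm_num
  have hle := norm_sum_le_of_le _ hterm
  rw [eq_neg_of_add_eq_zero_left hz3, norm_neg, norm_mul, Finset.sum_const, Finset.card_range,
    nsmul_eq_mul] at hle
  have hpos : 0 < ‖(P 0).eval z‖ * ‖f z‖ := mul_pos (norm_pos_iff.2 hz2) (norm_pos_iff.2 hz4)
  have h1 : 1 ≤ 2 * (C * n * 2 ^ n) * δ := by
    refine le_of_mul_le_mul_left ?_ hpos
    linarith
  have h2 : 2 * (C * n * 2 ^ n) * δ < 1 := by
    rw [hδ, mul_one_div, div_lt_one (by positivity)]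
    have : C * n * 2 ^ n ≤ C * (n + 1) * 2 ^ n := by gcongr; linarith
    linarith
  linarith
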